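/- Let $\Sigma$ be a smooth 3-manifold (Hausdorff, second countable, not necessarily connected) and $x^o\in\Sigma$. Let $\mathcal A^o$ be a space of connections on the trivial $U(1)$-bundle over $\Sigma$, i.e. a real vector space of real-valued $C^1$ 1-forms on $\Sigma$ (for instance those lying in a given Sobolev space) that contains all compactly supported $C^\infty$ 1-forms. For a continuous, piecewise $C^1$ loop $\alpha:[0,1]\to\Sigma$ based at $x^o$ and $A\in\mathcal A^o$ let $H(\alpha,A)=\exp\bigl(i\oint_\alpha A\bigr)\in U(1)$ be the holonomy. Call two such loops $\alpha,\beta$ equivalent if $H(\alpha,A)=H(\beta,A)$ for all $A\in\mathcal A^o$. The equivalence classes $\tilde\alpha$ (hoops) form a group $\mathcal{HG}$, the hoop group, with $\tilde\alpha\cdot\tilde\beta=\widetilde{\alpha\circ\beta}$, where $\circ$ is the composition of loops; the identity is the class of the constant loop and the inverse is given by reversal of loops. Let $\mathcal{HA}$ be the $\star$-algebra of all finite complex linear combinations $A\mapsto\sum_j a_j H(\alpha_j,A)$ of holonomies, regarded as functions on $\mathcal A^o$, and let $\overline{\mathcal{HA}}$, the $U(1)$ holonomy $C^\star$-algebra,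 be its completion in the sup norm over $\mathcal A^o$. For a point $\bar A$ of the (Gel'fand) spectrum of $\overline{\mathcal{HA}}$ and a hoop $\tilde\alpha$ write $\bar A(\tilde\alpha)$ for the value of $\bar A$ on the element $H(\alpha,\cdot)$. **Theorem A.4.** The group $\mathcal{HG}$ is Abelian and torsion-free. Every $\bar A$ in the spectrum of $\overline{\mathcal{HA}}$ defines a homomorphism $\hat H:\mathcal{HG}\to U(1)$ with $\hat H(\tilde\alpha)=\bar A(\tilde\alpha)$ for all $\tilde\alpha\in\mathcal{HG}$, and, conversely, every homomorphism $\hat H:\mathcal{HG}\to U(1)$ defines an element $\bar A$ of the spectrum with $\hat H(\tilde\alpha)=\bar A(\tilde\alpha)$ for all $\tilde\alpha\in\mathcal{HG}$. This is a one-to-one correspondence between the points of the spectrum and the homomorphisms $\mathcal{HG}\to U(1)$. -/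

import Mathlib

open Set MeasureTheory
open scoped Manifold ContDiff ENNReal

noncomputable section

namespace AbelianHolonomy

/-- The model space of a 3-manifold. -/
abbrev E3 : Type := EuclideanSpace ℝ (Fin 3)

/-- Real-valued 1-forms of class `C^1` on `M`, i.e. `C^1` sections of the cotangent bundle. They
are the `C^1` connections on the trivial `U(1)`-bundle over `M`. -/
abbrev OneForm (M : Type*) [TopologicalSpace M] [ChartedSpace E3 M] [IsManifold 𝓘(ℝ, E3) ∞ M] :
    Type _ :=
  ContMDiffSection 𝓘(ℝ, E3) (E3 →L[ℝ] ℝ) 1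
    (fun x : M => TangentSpace 𝓘(ℝ, E3) x →L[ℝ] Bundle.Trivial M ℝ x)

section Forms

variable {M : Type*} [TopologicalSpace M] [ChartedSpace E3 M] [IsManifold 𝓘(ℝ, E3) ∞ M]

/-- The 1-form `A` is of class `C^∞`. -/
def OneForm.IsSmooth (A : OneForm M) : Prop :=
  ContMDiff 𝓘(ℝ, E3) (𝓘(ℝ, E3).prod 𝓘(ℝ, E3 →L[ℝ] ℝ)) ∞
    (fun x => Bundle.TotalSpace.mk' (E3 →L[ℝ] ℝ)
      (E := fun x : M => TangentSpace 𝓘(ℝ, E3) x →L[ℝ] Bundle.Trivial M ℝ x) x (A x))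

/-- The 1-form `A` vanishes outside a compact set. -/
def OneForm.IsCompactlySupported (A : OneForm M) : Prop :=
  ∃ K : Set M, IsCompact K ∧ ∀ x ∉ K, A x = 0

end Forms

section Paths

variable {M : Type*} [TopologicalSpace M] [ChartedSpace E3 M]

/-- A (continuous) path `γ : [0, 1] → M` is piecewise `C^1` if there is a finite set `S` of
parameters such that `γ` is `C^1` on every closed interval `[a, b] ⊆ [0, 1]` that has no point of
`S` in its interior. -/
def IsPiecewiseC1 {x y : M} (γ : Path x y) : Prop :=
  ∃ S : Finset ℝ, ∀ a b : ℝ, 0 ≤ a → a < b → b ≤ 1 → (∀ s ∈ S, s ∉ Ioo a b) →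
    ContMDiffOn 𝓘(ℝ, ℝ) 𝓘(ℝ, E3) 1 γ.extend (Icc a b)

theorem IsPiecewiseC1.refl (x : M) : IsPiecewiseC1 (Path.refl x) :=
  ⟨∅, fun a b _ _ _ _ => by
    rw [Path.refl_extend]
    exact contMDiffOn_const⟩

theorem contMDiffOn_comp_affine {f : ℝ → M} {a b c d : ℝ} {s : Set ℝ}
    (hf : ContMDiffOn 𝓘(ℝ, ℝ) 𝓘(ℝ, E3) 1 f s) (h : MapsTo (fun t => c * t + d) (Icc a b) s) :
    ContMDiffOn 𝓘(ℝ, ℝ) 𝓘(ℝ, E3) 1 (fun t => f (c * t + d)) (Icc a b) := by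
  have h1 : ContMDiffOn 𝓘(ℝ, ℝ) 𝓘(ℝ, ℝ) 1 (fun t : ℝ => c * t + d) (Icc a b) := by
    rw [contMDiffOn_iff_contDiffOn]
    fun_prop
  exact hf.comp h1 h

theorem IsPiecewiseC1.symm {x y : M} {γ : Path x y} (h : IsPiecewiseC1 γ) :
    IsPiecewiseC1 γ.symm := by
  obtain ⟨S, hS⟩ := h
  refine ⟨S.image (fun s => 1 - s), fun a b ha hab hb hs => ?_⟩
  have h1 := hS (1 - b) (1 - a) (by linarith) (by linarith) (by linarith) (fun s hsS hm =>
    hs (1 - s) (Finset.mem_image_of_mem _ hsS) ⟨by linarith [hm.2], by linarith [hm.1]⟩)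
  have h2 := contMDiffOn_comp_affine (a := a) (b := b) (c := -1) (d := 1) h1
    (fun t ht => ⟨by linarith [ht.2], by linarith [ht.1]⟩)
  refine h2.congr (fun t _ => ?_)
  rw [Path.extend_symm_apply]
  congr 1
  ring

theorem IsPiecewiseC1.trans {x y z : M} {γ : Path x y} {γ' : Path y z} (h : IsPiecewiseC1 γ)
    (h' : IsPiecewiseC1 γ') : IsPiecewiseC1 (γ.trans γ') := by
  obtain ⟨S, hS⟩ := h
  obtain ⟨S', hS'⟩ := h'
  refine ⟨insert (1 / 2) (S.image (fun s => s / 2) ∪ S'.image (fun s => (s + 1) / 2)),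
    fun a b ha hab hb hs => ?_⟩
  have hhalf := hs (1 / 2) (Finset.mem_insert_self _ _)
  by_cases hb2 : b ≤ 1 / 2
  · have h1 := hS (2 * a) (2 * b) (by linarith) (by linarith) (by linarith) (fun s hsS hm =>
      hs (s / 2) (Finset.mem_insert_of_mem (Finset.mem_union_left _
        (Finset.mem_image_of_mem (fun s : ℝ => s / 2) hsS)))
        ⟨by linarith [hm.1], by linarith [hm.2]⟩)
    have h2 := contMDiffOn_comp_affine (a := a) (b := b) (c := 2) (d := 0) h1
      (fun t ht => ⟨by linarith [ht.1], by linarith [ht.2]⟩)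
    refine h2.congr (fun t ht => ?_)
    rw [Path.extend_trans_of_le_half _ _ (ht.2.trans hb2), add_zero]
  · have ha2 : 1 / 2 ≤ a := by
      by_contra hlt
      exact hhalf ⟨not_le.mp hlt, not_le.mp hb2⟩
    have h1 := hS' (2 * a - 1) (2 * b - 1) (by linarith) (by linarith) (by linarith)
      (fun s hsS hm => hs ((s + 1) / 2) (Finset.mem_insert_of_mem (Finset.mem_union_right _
        (Finset.mem_image_of_mem (fun s : ℝ => (s + 1) / 2) hsS)))
        ⟨by linarith [hm.1], by linarith [hm.2]⟩)
    have h2 := contMDiffOn_comp_affine (a := a) (b := b) (c := 2) (d := -1) h1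
      (fun t ht => ⟨by linarith [ht.1], by linarith [ht.2]⟩)
    refine h2.congr (fun t ht => ?_)
    rw [Path.extend_trans_of_half_le _ _ (ha2.trans ht.1), sub_eq_add_neg]

/-- The space of continuous, piecewise `C^1` loops based at `x₀`. -/
def BasedLoop (x₀ : M) : Type _ := {γ : Path x₀ x₀ // IsPiecewiseC1 γ}

/-- The trivial loop. -/
def BasedLoop.triv (x₀ : M) : BasedLoop x₀ := ⟨Path.refl x₀, IsPiecewiseC1.refl x₀⟩

/-- The composition `α ∘ β` of loops: first `β`, then `α`, each at double speed. -/
def BasedLoop.comp {x₀ : M} (α β : BasedLoop x₀) : BasedLoop x₀ :=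
  ⟨β.1.trans α.1, β.2.trans α.2⟩

/-- The loop `α` run backwards. -/
def BasedLoop.inv {x₀ : M} (α : BasedLoop x₀) : BasedLoop x₀ := ⟨α.1.symm, α.2.symm⟩

end Paths

section LineIntegral

variable {M : Type*} [TopologicalSpace M] [ChartedSpace E3 M] [IsManifold 𝓘(ℝ, E3) ∞ M]

/-- The function `t ↦ A (γ t) (γ' t)`. -/
def integrand (A : OneForm M) (γ : ℝ → M) (t : ℝ) : ℝ :=
  A (γ t) (mfderiv 𝓘(ℝ, ℝ) 𝓘(ℝ, E3) γ t (1 : ℝ))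

/-- The line integral `∫_γ A = ∫₀¹ A (γ t) (γ' t) dt`. -/
def lineIntegral (A : OneForm M) {x y : M} (γ : Path x y) : ℝ :=
  ∫ t in (0 : ℝ)..1, integrand A γ.extend t

theorem integrand_comp_affine (A : OneForm M) (f : ℝ → M) {c : ℝ} (hc : c ≠ 0) (d t : ℝ) :
    integrand A (fun s => f (c * s + d)) t = c * integrand A f (c * t + d) := by
  have key : ∀ (g : ℝ → M) (c d t : ℝ), MDifferentiableAt 𝓘(ℝ, ℝ) 𝓘(ℝ, E3) g (c * t + d) →
      HasMFDerivAt 𝓘(ℝ, ℝ) 𝓘(ℝ, E3) (fun s => g (c * s + d)) t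
        ((mfderiv 𝓘(ℝ, ℝ) 𝓘(ℝ, E3) g (c * t + d)).comp
          (ContinuousLinearMap.toSpanSingleton ℝ c : ℝ →L[ℝ] ℝ)) := by
    intro g c d t hg
    have h1 : HasFDerivAt (fun s : ℝ => c * s + d)
        (ContinuousLinearMap.toSpanSingleton ℝ c : ℝ →L[ℝ] ℝ) t := by
      have h2 : HasDerivAt (fun s : ℝ => c * s + d) c t := by
        simpa using ((hasDerivAt_id t).const_mul c).add_const d
      exact h2.hasFDerivAt
    exact HasMFDerivAt.comp t hg.hasMFDerivAt h1.hasMFDerivAt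
  by_cases hf : MDifferentiableAt 𝓘(ℝ, ℝ) 𝓘(ℝ, E3) f (c * t + d)
  · unfold integrand
    rw [(key f c d t hf).mfderiv]
    have h3 : ((mfderiv 𝓘(ℝ, ℝ) 𝓘(ℝ, E3) f (c * t + d)).comp
        (ContinuousLinearMap.toSpanSingleton ℝ c : ℝ →L[ℝ] ℝ)) (1 : ℝ)
        = c • (mfderiv 𝓘(ℝ, ℝ) 𝓘(ℝ, E3) f (c * t + d)) (1 : ℝ) := by
      change (mfderiv 𝓘(ℝ, ℝ) 𝓘(ℝ, E3) f (c * t + d)) ((1 : ℝ) • c : ℝ) = _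
      rw [show ((1 : ℝ) • c : ℝ) = c • (1 : ℝ) by simp]
      exact map_smul (mfderiv 𝓘(ℝ, ℝ) 𝓘(ℝ, E3) f (c * t + d)) c (1 : ℝ)
    refine (congrArg (fun v => A (f (c * t + d)) v) h3).trans ?_
    exact map_smul (A (f (c * t + d))) c _
  · have hf' : ¬ MDifferentiableAt 𝓘(ℝ, ℝ) 𝓘(ℝ, E3) (fun s => f (c * s + d)) t := by
      intro h
      apply hf
      have he : c⁻¹ * (c * t + d) + -(c⁻¹ * d) = t := by field_simp; ring
      have h4 := (key (fun s => f (c * s + d)) c⁻¹ (-(c⁻¹ * d)) (c * t + d)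
        (by rw [he]; exact h)).mdifferentiableAt
      have h5 : (fun s => (fun s => f (c * s + d)) (c⁻¹ * s + -(c⁻¹ * d))) = f := by
        funext s
        change f (c * (c⁻¹ * s + -(c⁻¹ * d)) + d) = f s
        congr 1
        field_simp
        ring
      rwa [h5] at h4
    unfold integrand
    rw [mfderiv_zero_of_not_mdifferentiableAt hf, mfderiv_zero_of_not_mdifferentiableAt hf']
    have h6 := map_zero (A (f (c * t + d)))
    refine Eq.trans (b := (0 : ℝ)) h6 ?_
    refine Eq.symm (Eq.trans (congrArg (fun r : ℝ => c * r) h6) (mul_zero c))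

theorem integrand_congr (A : OneForm M) {f g : ℝ → M} {t : ℝ} (h : f =ᶠ[nhds t] g) :
    integrand A f t = integrand A g t := by
  unfold integrand
  rw [h.mfderiv_eq, h.self_of_nhds]

theorem continuousOn_integrandWithin (A : OneForm M) {f : ℝ → M} {a b : ℝ} (hab : a < b)
    (hf : ContMDiffOn 𝓘(ℝ, ℝ) 𝓘(ℝ, E3) 1 f (Icc a b)) :
    ContinuousOn (fun t => (A (f t) (mfderivWithin 𝓘(ℝ, ℝ) 𝓘(ℝ, E3) f (Icc a b) t (1 : ℝ)) : ℝ))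
      (Icc a b) := by
  have h1 := hf.continuousOn_tangentMapWithin le_rfl (uniqueMDiffOn_iff_uniqueDiffOn.mpr
    (uniqueDiffOn_Icc hab))
  have h2 : Continuous (fun t : ℝ => (⟨t, (1 : ℝ)⟩ : TangentBundle 𝓘(ℝ, ℝ) ℝ)) := by
    have h3 : Continuous (fun t : ℝ => (tangentBundleModelSpaceHomeomorph 𝓘(ℝ, ℝ)).symm
        ((t, (1 : ℝ)) : ModelProd ℝ ℝ)) :=
      (tangentBundleModelSpaceHomeomorph 𝓘(ℝ, ℝ)).symm.continuous.comp (by fun_prop)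
    exact h3
  have h4 : ContinuousOn (fun t => Bundle.TotalSpace.mk' E3 (E := TangentSpace 𝓘(ℝ, E3)) (f t)
      (mfderivWithin 𝓘(ℝ, ℝ) 𝓘(ℝ, E3) f (Icc a b) t (1 : ℝ))) (Icc a b) :=
    h1.comp h2.continuousOn (fun t ht => ht)
  have h5 : ContinuousOn (fun t => Bundle.TotalSpace.mk' (E3 →L[ℝ] ℝ)
      (E := fun x : M => TangentSpace 𝓘(ℝ, E3) x →L[ℝ] Bundle.Trivial M ℝ x) (f t) (A (f t)))
      (Icc a b) :=
    A.contMDiff.continuous.comp_continuousOn hf.continuousOn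
  have h6 := ContinuousOn.clm_bundle_apply h5 h4
  intro t ht
  exact ((FiberBundle.continuousWithinAt_totalSpace _ _).mp (h6 t ht)).2

theorem intervalIntegrable_integrand (A : OneForm M) {x y : M} {γ : Path x y}
    (h : IsPiecewiseC1 γ) : IntervalIntegrable (integrand A γ.extend) volume 0 1 := by
  obtain ⟨S, hS⟩ := h
  have key : ∀ (S : Finset ℝ) (a b : ℝ), a ≤ b → (∀ c d : ℝ, a ≤ c → c < d → d ≤ b →
      (∀ s ∈ S, s ∉ Ioo c d) → IntervalIntegrable (integrand A γ.extend) volume c d) →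
      IntervalIntegrable (integrand A γ.extend) volume a b := by
    intro S
    induction S using Finset.induction_on with
    | empty =>
      intro a b hab H
      rcases hab.eq_or_lt with rfl | hlt
      · exact IntervalIntegrable.refl
      · exact H a b le_rfl hlt le_rfl (by simp)
    | insert s S _ ih =>
      intro a b hab H
      by_cases hs : s ∈ Ioo a b
      · refine (ih a s hs.1.le fun c d hc hcd hd hS => H c d hc hcd (hd.trans hs.2.le) ?_).trans
          (ih s b hs.2.le fun c d hc hcd hd hS => H c d (hs.1.le.trans hc) hcd hd ?_)
        · intro r hr
          rcases Finset.mem_insert.mp hr with rfl | hr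
          · exact fun hm => absurd hm.2 (not_lt.mpr hd)
          · exact hS r hr
        · intro r hr
          rcases Finset.mem_insert.mp hr with rfl | hr
          · exact fun hm => absurd hm.1 (not_lt.mpr hc)
          · exact hS r hr
      · refine ih a b hab fun c d hc hcd hd hS => H c d hc hcd hd fun r hr => ?_
        rcases Finset.mem_insert.mp hr with rfl | hr
        · exact fun hm => hs ⟨hc.trans_lt hm.1, hm.2.trans_le hd⟩
        · exact hS r hr
  refine key S 0 1 zero_le_one fun c d hc hcd hd hs => ?_
  have h1 := continuousOn_integrandWithin A hcd (hS c d hc hcd hd hs)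
  rw [← uIcc_of_le hcd.le] at h1
  refine h1.intervalIntegrable.congr_ae ?_
  rw [uIoc_of_le hcd.le, ← restrict_Ioo_eq_restrict_Ioc]
  filter_upwards [ae_restrict_mem measurableSet_Ioo] with t ht
  rw [uIcc_of_le hcd.le, mfderivWithin_of_mem_nhds (Icc_mem_nhds ht.1 ht.2)]
  rfl

theorem lineIntegral_refl (A : OneForm M) (x : M) : lineIntegral A (Path.refl x) = 0 := by
  have h : ∀ t : ℝ, integrand A (Path.refl x).extend t = 0 := fun t => by
    unfold integrand
    rw [Path.refl_extend]
    have h0 : mfderiv 𝓘(ℝ, ℝ) 𝓘(ℝ, E3) (ContinuousMap.const ℝ x) t = 0 := mfderiv_const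
    rw [h0]
    exact map_zero (A x)
  unfold lineIntegral
  rw [intervalIntegral.integral_congr (g := fun _ => (0 : ℝ)) (fun t _ => h t)]
  simp

theorem lineIntegral_symm (A : OneForm M) {x y : M} (γ : Path x y) :
    lineIntegral A γ.symm = -lineIntegral A γ := by
  have h : ∀ t : ℝ, integrand A γ.symm.extend t = -integrand A γ.extend (1 - t) := fun t => by
    have h1 := integrand_comp_affine A γ.extend (c := -1) (by norm_num) 1 t
    rw [show -1 * t + 1 = 1 - t by ring, neg_one_mul] at h1
    rw [← h1]
    refine integrand_congr A (Filter.Eventually.of_forall fun s => ?_)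
    rw [Path.extend_symm_apply]
    congr 1
    ring
  unfold lineIntegral
  rw [intervalIntegral.integral_congr
      (g := fun t => -integrand A γ.extend (1 - t)) (fun t _ => h t),
    intervalIntegral.integral_neg,
    intervalIntegral.integral_comp_sub_left (f := integrand A γ.extend)]
  norm_num

theorem lineIntegral_trans (A : OneForm M) {x y z : M} {γ : Path x y} {γ' : Path y z}
    (h : IsPiecewiseC1 γ) (h' : IsPiecewiseC1 γ') :
    lineIntegral A (γ.trans γ') = lineIntegral A γ + lineIntegral A γ' := by
  have hi := intervalIntegrable_integrand A (h.trans h')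
  have hL : ∀ t ∈ Ioo (0 : ℝ) (1 / 2), integrand A (γ.trans γ').extend t
      = 2 * integrand A γ.extend (2 * t) := fun t ht => by
    have h1 := integrand_comp_affine A γ.extend (c := 2) (by norm_num) 0 t
    rw [add_zero] at h1
    rw [← h1]
    refine integrand_congr A ?_
    filter_upwards [Iio_mem_nhds ht.2] with s hs
    rw [Path.extend_trans_of_le_half _ _ (le_of_lt hs), add_zero]
  have hR : ∀ t ∈ Ioo (1 / 2 : ℝ) 1, integrand A (γ.trans γ').extend t
      = 2 * integrand A γ'.extend (2 * t - 1) := fun t ht => by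
    have h1 := integrand_comp_affine A γ'.extend (c := 2) (by norm_num) (-1) t
    rw [← sub_eq_add_neg] at h1
    rw [← h1]
    refine integrand_congr A ?_
    filter_upwards [Ioi_mem_nhds ht.1] with s hs
    rw [Path.extend_trans_of_half_le _ _ (le_of_lt hs), sub_eq_add_neg]
  have hsplit : ∀ (a b : ℝ) (f g : ℝ → ℝ), a ≤ b → (∀ t ∈ Ioo a b, f t = g t) →
      ∫ t in a..b, f t = ∫ t in a..b, g t := fun a b f g hab hfg => by
    refine intervalIntegral.integral_congr_ae_restrict ?_
    rw [uIoc_of_le hab, ← restrict_Ioo_eq_restrict_Ioc]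
    filter_upwards [ae_restrict_mem measurableSet_Ioo] with t ht using hfg t ht
  unfold lineIntegral
  rw [← intervalIntegral.integral_add_adjacent_intervals (b := 1 / 2)
    (hi.mono_set (by
      rw [uIcc_of_le (by norm_num), uIcc_of_le (by norm_num)]
      exact Icc_subset_Icc le_rfl (by norm_num)))
    (hi.mono_set (by
      rw [uIcc_of_le (by norm_num), uIcc_of_le (by norm_num)]
      exact Icc_subset_Icc (by norm_num) le_rfl)),
    hsplit _ _ _ _ (by norm_num) hL, hsplit _ _ _ _ (by norm_num) hR,
    intervalIntegral.integral_const_mul, intervalIntegral.integral_const_mul,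
    intervalIntegral.mul_integral_comp_mul_left (f := integrand A γ.extend),
    intervalIntegral.mul_integral_comp_mul_sub (f := integrand A γ'.extend)]
  norm_num

/-- The holonomy `H(α, A) = exp (i ∮_α A)` of the connection `A` around the loop `α`. -/
def holonomy {x₀ : M} (α : BasedLoop x₀) (A : OneForm M) : Circle :=
  Circle.exp (lineIntegral A α.1)

theorem holonomy_triv (x₀ : M) (A : OneForm M) : holonomy (BasedLoop.triv x₀) A = 1 := by
  simp [holonomy, BasedLoop.triv, lineIntegral_refl]

theorem holonomy_comp {x₀ : M} (α β : BasedLoop x₀) (A : OneForm M) :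
    holonomy (α.comp β) A = holonomy α A * holonomy β A := by
  simp [holonomy, BasedLoop.comp, lineIntegral_trans A β.2 α.2, Circle.exp_add, mul_comm]

theorem holonomy_inv {x₀ : M} (α : BasedLoop x₀) (A : OneForm M) :
    holonomy α.inv A = (holonomy α A)⁻¹ := by
  simp [holonomy, BasedLoop.inv, lineIntegral_symm, Circle.exp_neg]

end LineIntegral

section Hoops

variable {M : Type*} [TopologicalSpace M] [ChartedSpace E3 M] [IsManifold 𝓘(ℝ, E3) ∞ M]

/-- Holonomic equivalence of based loops, with respect to the space `𝒜` of connections: the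
holonomies around the two loops agree for every connection in `𝒜`. -/
def holonomySetoid (𝒜 : Submodule ℝ (OneForm M)) (x₀ : M) : Setoid (BasedLoop x₀) where
  r α β := ∀ A ∈ 𝒜, holonomy α A = holonomy β A
  iseqv := ⟨fun _ _ _ => rfl, fun h A hA => (h A hA).symm,
    fun h h' A hA => (h A hA).trans (h' A hA)⟩

/-- The set of hoops, i.e. of holonomic equivalence classes of loops based at `x₀`. -/
def HoopGroup (𝒜 : Submodule ℝ (OneForm M)) (x₀ : M) : Type _ := Quotient (holonomySetoid 𝒜 x₀)

variable {𝒜 : Submodule ℝ (OneForm M)} {x₀ : M}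

/-- The hoop of a loop. -/
def BasedLoop.toHoop (𝒜 : Submodule ℝ (OneForm M)) (α : BasedLoop x₀) : HoopGroup 𝒜 x₀ :=
  Quotient.mk (holonomySetoid 𝒜 x₀) α

/-- The (well-defined) holonomy of a connection around a hoop. -/
def HoopGroup.hol (a : HoopGroup 𝒜 x₀) (A : 𝒜) : Circle :=
  Quotient.lift (s := holonomySetoid 𝒜 x₀) (fun α => holonomy α A.1) (fun _ _ h => h A.1 A.2) a

theorem HoopGroup.ext_hol {a b : HoopGroup 𝒜 x₀} (h : ∀ A : 𝒜, a.hol A = b.hol A) : a = b := by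
  induction a using Quotient.inductionOn
  induction b using Quotient.inductionOn
  exact Quotient.sound (s := holonomySetoid 𝒜 x₀) (fun A hA => h ⟨A, hA⟩)

/-- The product of hoops is induced by the composition of loops. -/
instance : Mul (HoopGroup 𝒜 x₀) where
  mul := Quotient.map₂ (sa := holonomySetoid 𝒜 x₀) (sb := holonomySetoid 𝒜 x₀)
    (sc := holonomySetoid 𝒜 x₀) BasedLoop.comp (fun α α' h β β' h' A hA => by
      rw [holonomy_comp, holonomy_comp, h A hA, h' A hA])

/-- The identity is the hoop of the trivial loop. -/
instance : One (HoopGroup 𝒜 x₀) where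
  one := (BasedLoop.triv x₀).toHoop 𝒜

/-- The inverse of hoops is induced by the reversal of loops. -/
instance : Inv (HoopGroup 𝒜 x₀) where
  inv := Quotient.map (sa := holonomySetoid 𝒜 x₀) (sb := holonomySetoid 𝒜 x₀)
    BasedLoop.inv (fun α α' h A hA => by rw [holonomy_inv, holonomy_inv, h A hA])

theorem HoopGroup.hol_mul (a b : HoopGroup 𝒜 x₀) (A : 𝒜) : (a * b).hol A = a.hol A * b.hol A := by
  induction a using Quotient.inductionOn
  induction b using Quotient.inductionOn
  exact holonomy_comp _ _ A.1

theorem HoopGroup.hol_one (A : 𝒜) : (1 : HoopGroup 𝒜 x₀).hol A = 1 :=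
  holonomy_triv x₀ A.1

theorem HoopGroup.hol_inv (a : HoopGroup 𝒜 x₀) (A : 𝒜) : (a⁻¹).hol A = (a.hol A)⁻¹ := by
  induction a using Quotient.inductionOn
  exact holonomy_inv _ A.1

/-- The hoop group, which is Abelian. -/
instance : CommGroup (HoopGroup 𝒜 x₀) where
  mul_assoc a b c := HoopGroup.ext_hol fun A => by simp only [HoopGroup.hol_mul, mul_assoc]
  one_mul a := HoopGroup.ext_hol fun A => by
    simp only [HoopGroup.hol_mul, HoopGroup.hol_one, one_mul]
  mul_one a := HoopGroup.ext_hol fun A => by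
    simp only [HoopGroup.hol_mul, HoopGroup.hol_one, mul_one]
  inv_mul_cancel a := HoopGroup.ext_hol fun A => by
    simp only [HoopGroup.hol_mul, HoopGroup.hol_one, HoopGroup.hol_inv, inv_mul_cancel]
  mul_comm a b := HoopGroup.ext_hol fun A => by simp only [HoopGroup.hol_mul, mul_comm]

end Hoops

section HolonomyAlgebra

variable {M : Type*} [TopologicalSpace M] [ChartedSpace E3 M] [IsManifold 𝓘(ℝ, E3) ∞ M]

/-- The `C⋆`-algebra of all bounded complex-valued functions on the space `𝒜` of connections, with
pointwise operations and the sup norm. -/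
abbrev BoundedFunctions (𝒜 : Submodule ℝ (OneForm M)) : Type _ := lp (fun _ : 𝒜 => ℂ) ∞

variable (𝒜 : Submodule ℝ (OneForm M)) (x₀ : M)

/-- The function `A ↦ H(a, A)` on `𝒜` defined by a hoop `a`. -/
def holonomyFun (a : HoopGroup 𝒜 x₀) : BoundedFunctions 𝒜 :=
  ⟨fun A => (a.hol A : ℂ), memℓp_infty ⟨1, by
    rintro _ ⟨A, rfl⟩
    exact (Circle.norm_coe _).le⟩⟩

theorem holonomyFun_mul (a b : HoopGroup 𝒜 x₀) :
    holonomyFun 𝒜 x₀ (a * b) = holonomyFun 𝒜 x₀ a * holonomyFun 𝒜 x₀ b := by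
  ext A
  simp [holonomyFun, HoopGroup.hol_mul]

theorem holonomyFun_one : holonomyFun 𝒜 x₀ 1 = 1 := by
  ext A
  simp [holonomyFun, HoopGroup.hol_one]

theorem star_holonomyFun (a : HoopGroup 𝒜 x₀) :
    star (holonomyFun 𝒜 x₀ a) = holonomyFun 𝒜 x₀ a⁻¹ := by
  ext A
  simp only [holonomyFun, HoopGroup.hol_inv, Circle.coe_inv_eq_conj]
  rfl

theorem span_mul_mem {B : Type*} [Ring B] [Algebra ℂ B] {s : Set B}
    (hs : ∀ f ∈ s, ∀ g ∈ s, f * g ∈ s) {f g : B} (hf : f ∈ Submodule.span ℂ s)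
    (hg : g ∈ Submodule.span ℂ s) : f * g ∈ Submodule.span ℂ s := by
  have h := Submodule.mul_mem_mul hf hg
  rw [Submodule.span_mul_span] at h
  exact Submodule.span_mono (Set.mul_subset_iff.mpr hs) h

theorem span_star_mem {B : Type*} [Ring B] [Algebra ℂ B] [StarRing B] [StarModule ℂ B]
    {s : Set B} (hs : ∀ f ∈ s, star f ∈ s) {f : B} (hf : f ∈ Submodule.span ℂ s) :
    star f ∈ Submodule.span ℂ s := by
  induction hf using Submodule.span_induction with
  | zero => rw [star_zero]; exact zero_mem _
  | add f₁ f₂ _ _ h₁ h₂ => rw [star_add]; exact add_mem h₁ h₂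
  | smul c f _ h => rw [star_smul]; exact Submodule.smul_mem _ _ h
  | mem f hf => exact Submodule.subset_span (hs f hf)

/-- The holonomy `⋆`-algebra: the finite linear combinations `∑ j, c j • H(a j, ·)` of holonomies
around hoops, as functions on `𝒜`. -/
def holonomyAlgebra : StarSubalgebra ℂ (BoundedFunctions 𝒜) where
  carrier := Submodule.span ℂ (range (holonomyFun 𝒜 x₀))
  zero_mem' := zero_mem _
  add_mem' := add_mem
  mul_mem' := span_mul_mem (by
    rintro _ ⟨a, rfl⟩ _ ⟨b, rfl⟩
    exact ⟨a * b, holonomyFun_mul 𝒜 x₀ a b⟩)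
  algebraMap_mem' c := by
    rw [Algebra.algebraMap_eq_smul_one]
    exact Submodule.smul_mem _ c (Submodule.subset_span ⟨1, holonomyFun_one 𝒜 x₀⟩)
  star_mem' := span_star_mem (by
    rintro _ ⟨a, rfl⟩
    exact ⟨a⁻¹, (star_holonomyFun 𝒜 x₀ a).symm⟩)

/-- The holonomy `C⋆`-algebra: the completion of the holonomy `⋆`-algebra in the sup norm, i.e. its
closure in the (complete) algebra of bounded functions. -/
abbrev HolonomyCStarAlgebra : Type _ := (holonomyAlgebra 𝒜 x₀).topologicalClosure

/-- The generator of the holonomy `C⋆`-algebra defined by a hoop. -/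
def hoopElement (a : HoopGroup 𝒜 x₀) : HolonomyCStarAlgebra 𝒜 x₀ :=
  ⟨holonomyFun 𝒜 x₀ a, subset_closure (Submodule.subset_span (mem_range_self a))⟩

end HolonomyAlgebra

end AbelianHolonomy

end

noncomputable section

namespace AbelianHolonomy

/-! ### Linearity in the connection, torsion-freeness and separation of hoops -/

section LineIntegral

variable {M : Type*} [TopologicalSpace M] [ChartedSpace E3 M] [IsManifold 𝓘(ℝ, E3) ∞ M]

/-! Everything rests on `𝒜` being a real vector space on which line integrals are linear. Dividing a
connection by `n` gives torsion-freeness; rescaling one that separates two hoops makes their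
holonomies opposite (`HoopGroup.exists_hol_eq_neg`).

A point of the spectrum restricts to a character of the hoop group, since hoop elements and their
inverses have norm at most 1, and density of their span makes this restriction injective. For
surjectivity, a character `χ` must satisfy `|∑ c_g χ(g)| ≤ sup_A |∑ c_g H(g, A)|`; it then extends
by continuity (`exists_characterSpace_apply_eq`).

This bound is `norm_groupAlgebraEval_le`. Averaging over translates of `A` removes all terms but
one, so each coefficient is at most the sup norm `C` (`norm_coeff_le_of_insert`). For `f ^ n` this
gives coefficients at most `C ^ n`, while commutativity leaves only polynomially many of them
(`card_support_pow_le`). Hence `|χ(f)| ^ n ≤ (n + 1) ^ k * C ^ n` for all `n`, which forces `|χ(f)|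
≤ C`. -/

theorem lineIntegral_add (A B : OneForm M) {x y : M} {γ : Path x y} (h : IsPiecewiseC1 γ) :
    lineIntegral (A + B) γ = lineIntegral A γ + lineIntegral B γ :=
  intervalIntegral.integral_add (intervalIntegrable_integrand A h)
    (intervalIntegrable_integrand B h)

theorem lineIntegral_smul (c : ℝ) (A : OneForm M) {x y : M} (γ : Path x y) :
    lineIntegral (c • A) γ = c * lineIntegral A γ :=
  intervalIntegral.integral_const_mul c (integrand A γ.extend)

variable {𝒜 : Submodule ℝ (OneForm M)} {x₀ : M}

theorem HoopGroup.hol_add (a : HoopGroup 𝒜 x₀) (A B : 𝒜) :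
    a.hol (A + B) = a.hol A * a.hol B := by
  induction a using Quotient.inductionOn with
  | h α =>
    change holonomy α (A.1 + B.1) = holonomy α A.1 * holonomy α B.1
    simp only [holonomy, lineIntegral_add _ _ α.2, Circle.exp_add]

theorem HoopGroup.hol_nsmul (a : HoopGroup 𝒜 x₀) (n : ℕ) (A : 𝒜) :
    a.hol ⟨(n : ℝ) • A.1, 𝒜.smul_mem _ A.2⟩ = a.hol A ^ n := by
  induction a using Quotient.inductionOn with
  | h α =>
    change holonomy α ((n : ℝ) • A.1) = holonomy α A.1 ^ n
    simp only [holonomy, lineIntegral_smul]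
    induction n with
    | zero => simp
    | succ n ih => rw [pow_succ, ← ih, ← Circle.exp_add]; push_cast; ring_nf

/-- The holonomies of distinct hoops are opposite for some connection. -/
theorem HoopGroup.exists_hol_eq_neg {a b : HoopGroup 𝒜 x₀} (h : a ≠ b) :
    ∃ A : 𝒜, (a.hol A : ℂ) = -b.hol A := by
  obtain ⟨A, hA⟩ := not_forall.mp (mt HoopGroup.ext_hol h)
  induction a using Quotient.inductionOn with
  | h α =>
  induction b using Quotient.inductionOn with
  | h β =>
    have hne : lineIntegral A.1 α.1 - lineIntegral A.1 β.1 ≠ 0 := fun h0 =>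
      hA (congrArg Circle.exp (sub_eq_zero.mp h0))
    -- This scaling makes the two line integrals differ by exactly `π`.
    set c := Real.pi / (lineIntegral A.1 α.1 - lineIntegral A.1 β.1) with hc
    refine ⟨⟨c • A.1, 𝒜.smul_mem c A.2⟩, ?_⟩
    change (holonomy α (c • A.1) : ℂ) = -(holonomy β (c • A.1) : ℂ)
    have key : c * lineIntegral A.1 α.1 = c * lineIntegral A.1 β.1 + Real.pi := by
      rw [hc]; field_simp; ring
    simp only [holonomy, lineIntegral_smul]
    rw [key, Circle.exp_add, Circle.coe_mul, Circle.coe_exp Real.pi, Complex.exp_pi_mul_I,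
      mul_neg_one]

/-- The holonomy of `c` at `A` is that of `c ^ n` at `A / n`, so the `n`-th power determines the
hoop. -/
theorem HoopGroup.isMulTorsionFree : IsMulTorsionFree (HoopGroup 𝒜 x₀) where
  pow_left_injective n hn a b hab := by
    refine HoopGroup.ext_hol fun A => ?_
    have hpow : ∀ (c : HoopGroup 𝒜 x₀) (B : 𝒜) (m : ℕ), (c ^ m).hol B = c.hol B ^ m := by
      intro c B m
      induction m with
      | zero => simp [HoopGroup.hol_one]
      | succ m ih => rw [pow_succ, HoopGroup.hol_mul, ih, pow_succ]
    set B : 𝒜 := ⟨(n : ℝ)⁻¹ • A.1, 𝒜.smul_mem _ A.2⟩ with hB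
    have hA : A = ⟨(n : ℝ) • B.1, 𝒜.smul_mem _ B.2⟩ :=
      Subtype.ext (smul_inv_smul₀ (Nat.cast_ne_zero.mpr hn) A.1).symm
    rw [hA, HoopGroup.hol_nsmul, HoopGroup.hol_nsmul, ← hpow, ← hpow]
    exact congrArg (fun c : HoopGroup 𝒜 x₀ => c.hol _) hab

end LineIntegral

/-! ### Bounding all characters by a separating family: coefficients and the power trick -/

section GroupAlgebra

/-- If `x ^ n` exceeds `y ^ n` by at most a polynomial factor, then `x ≤ y`. -/
theorem le_of_forall_pow_le_poly_mul_pow {x y : ℝ} (hy : 0 ≤ y) (k : ℕ)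
    (h : ∀ n : ℕ, x ^ n ≤ ((n : ℝ) + 1) ^ k * y ^ n) : x ≤ y := by
  by_contra! hlt
  have hx : 0 < x := hy.trans_lt hlt
  rcases hy.eq_or_lt with rfl | hy
  · have := h 1
    simp only [pow_one, mul_zero] at this
    exact this.not_gt hx
  have hr : 1 < x / y := (one_lt_div hy).mpr hlt
  -- The index is shifted to match the factor `(n + 1) ^ k`; comparing with `(x / y)⁻¹` rather than
  -- 1 absorbs the extra power of `x / y`.
  have hlim := (tendsto_pow_const_div_const_pow_of_one_lt k hr).comp (Filter.tendsto_add_atTop_nat 1)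
  obtain ⟨n, hn⟩ := (hlim.eventually (gt_mem_nhds (inv_pos.mpr (one_pos.trans hr)))).exists
  have hpos : 0 < (x / y) ^ n := pow_pos (one_pos.trans hr) n
  simp only [Function.comp_apply, Nat.cast_add, Nat.cast_one, pow_succ] at hn
  rw [div_lt_iff₀ (mul_pos hpos (one_pos.trans hr)), mul_comm ((x / y) ^ n),
    inv_mul_cancel_left₀ (one_pos.trans hr).ne', div_pow, lt_div_iff₀ (pow_pos hy n)] at hn
  exact (h n).not_gt hn

variable {G V : Type*} [CommGroup G]

/-- The character of the group algebra defined by a character of the group. -/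
def groupAlgebraEval (χ : G →* Circle) : MonoidAlgebra ℂ G →ₐ[ℂ] ℂ :=
  MonoidAlgebra.lift ℂ ℂ G (Circle.coeHom.comp χ)

theorem groupAlgebraEval_apply (χ : G →* Circle) (f : MonoidAlgebra ℂ G) :
    groupAlgebraEval χ f = ∑ g ∈ f.coeff.support, f.coeff g * χ g := by
  rw [groupAlgebraEval, MonoidAlgebra.lift_apply, Finsupp.sum]
  rfl

variable [AddCommGroup V] {e : V → G →* Circle}

/-- The coefficients of a trigonometric polynomial are bounded by its supremum norm. -/
theorem norm_coeff_le_of_insert [DecidableEq G] (he : ∀ A B g, e (A + B) g = e A g * e B g)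
    (hsep : ∀ a b : G, a ≠ b → ∃ A, (e A a : ℂ) = -e A b) (a : G) (S : Finset G) (ha : a ∉ S)
    (c : G → ℂ) {C : ℝ} (hC : ∀ A, ‖∑ g ∈ insert a S, c g * e A g‖ ≤ C) : ‖c a‖ ≤ C := by
  induction S using Finset.induction_on generalizing c with
  | empty =>
    have h0 := hC 0
    rwa [insert_empty_eq, Finset.sum_singleton, norm_mul, Circle.norm_coe, mul_one] at h0
  | insert b S hb ih =>
    have hab : b ≠ a := fun h => ha (h ▸ Finset.mem_insert_self _ _)
    have haS : a ∉ S := fun h => ha (Finset.mem_insert_of_mem h)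
    obtain ⟨B, hB⟩ := hsep b a hab
    have hB0 : (e B a : ℂ) ≠ 0 := Circle.coe_ne_zero _
    -- The multiplier is 1 at `a` and 0 at `b`. The new polynomial at `A` averages the old one at
    -- `A` with the old one at `A + B` divided by the unimodular `e B a`, so the bound `C` survives.
    have key := ih haS (fun g => c g * ((1 + (e B g : ℂ) / e B a) / 2)) fun A => by
      have hsum : ∑ g ∈ insert a S, c g * ((1 + (e B g : ℂ) / e B a) / 2) * e A g
          = (∑ g ∈ insert a (insert b S), c g * e A g
            + (∑ g ∈ insert a (insert b S), c g * e (A + B) g) / e B a) / 2 := by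
        rw [Finset.insert_comm, Finset.sum_div, ← Finset.sum_add_distrib, Finset.sum_div,
          Finset.sum_insert (a := b) (by simp [hab, hb])]
        have h0 : (c b * e A b + c b * e (A + B) b / e B a) / 2 = 0 := by
          rw [he, Circle.coe_mul, hB]
          field_simp
          ring
        rw [h0, zero_add]
        refine Finset.sum_congr rfl fun g _ => ?_
        rw [he, Circle.coe_mul]
        field_simp
      have h2 : ‖(2 : ℂ)‖ = 2 := by simp
      rw [hsum, norm_div, h2, div_le_iff₀ two_pos]
      refine (norm_add_le _ _).trans ?_
      rw [norm_div, Circle.norm_coe, div_one]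
      linarith [hC A, hC (A + B)]
    simpa [div_self hB0] using key

theorem norm_coeff_le (he : ∀ A B g, e (A + B) g = e A g * e B g)
    (hsep : ∀ a b : G, a ≠ b → ∃ A, (e A a : ℂ) = -e A b) (f : MonoidAlgebra ℂ G) {C : ℝ}
    (hC : ∀ A, ‖groupAlgebraEval (e A) f‖ ≤ C) (a : G) : ‖f.coeff a‖ ≤ C := by
  classical
  by_cases ha : a ∈ f.coeff.support
  · refine norm_coeff_le_of_insert he hsep a (f.coeff.support.erase a) (by simp) f.coeff
      fun A => ?_
    rw [Finset.insert_erase ha, ← groupAlgebraEval_apply]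
    exact hC A
  · rw [Finsupp.notMem_support_iff.mp ha, norm_zero]
    exact (norm_nonneg _).trans (hC 0)

/-- As `G` is commutative, a product of `n` support elements depends only on their multiplicities,
each between 0 and `n`. -/
theorem card_support_pow_le (f : MonoidAlgebra ℂ G) (n : ℕ) :
    (f ^ n).coeff.support.card ≤ (n + 1) ^ f.coeff.support.card := by
  classical
  set T : ℕ → Finset (f.coeff.support → ℕ) := fun n =>
    Fintype.piFinset fun _ => Finset.range (n + 1)
  have hsub : (f ^ n).coeff.support ⊆ (T n).image fun m => ∏ g : f.coeff.support, (g : G) ^ m g := by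
    induction n with
    | zero =>
      intro g hg
      rw [pow_zero] at hg
      have h1 : g = 1 := by simpa using MonoidAlgebra.support_coeff_one_subset hg
      refine Finset.mem_image.mpr ⟨0, Fintype.mem_piFinset.mpr fun _ => by simp, by simp [h1]⟩
    | succ n ih =>
      intro g hg
      rw [pow_succ] at hg
      obtain ⟨a, ha, b, hb, rfl⟩ := Finset.mem_mul.mp (MonoidAlgebra.support_coeff_mul_subset _ _ hg)
      obtain ⟨m, hm, rfl⟩ := Finset.mem_image.mp (ih ha)
      refine Finset.mem_image.mpr ⟨m + Pi.single ⟨b, hb⟩ 1, ?_, ?_⟩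
      · simp only [T, Fintype.mem_piFinset, Finset.mem_range, Pi.add_apply] at hm ⊢
        intro i
        have h1 : (Pi.single ⟨b, hb⟩ 1 : f.coeff.support → ℕ) i ≤ 1 := by
          rw [Pi.single_apply]; split_ifs <;> simp
        have := hm i
        omega
      · simp only [Pi.add_apply, pow_add, Finset.prod_mul_distrib]
        congr 1
        rw [Finset.prod_eq_single ⟨b, hb⟩] <;> simp +contextual
  refine (Finset.card_le_card hsub).trans (Finset.card_image_le.trans ?_)
  simp [T]

/-- If the characters `e A` separate the elements of `G`, then the values of an element of the group
algebra at all characters of `G` are bounded by those at the characters `e A`. -/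
theorem norm_groupAlgebraEval_le (he : ∀ A B g, e (A + B) g = e A g * e B g)
    (hsep : ∀ a b : G, a ≠ b → ∃ A, (e A a : ℂ) = -e A b) (χ : G →* Circle)
    (f : MonoidAlgebra ℂ G) {C : ℝ} (hC : ∀ A, ‖groupAlgebraEval (e A) f‖ ≤ C) :
    ‖groupAlgebraEval χ f‖ ≤ C := by
  have hC0 : 0 ≤ C := (norm_nonneg _).trans (hC 0)
  -- The power trick: losing a factor polynomial in `n` on `f ^ n` costs nothing in the limit.
  refine le_of_forall_pow_le_poly_mul_pow hC0 f.coeff.support.card fun n => ?_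
  have hcoeff := norm_coeff_le he hsep (f ^ n) (C := C ^ n) fun A => by
    rw [map_pow, norm_pow]
    exact pow_le_pow_left₀ (norm_nonneg _) (hC A) n
  rw [← norm_pow, ← map_pow, groupAlgebraEval_apply]
  calc _ ≤ ∑ g ∈ (f ^ n).coeff.support, C ^ n := norm_sum_le_of_le _ fun g _ => by
          rw [norm_mul, Circle.norm_coe, mul_one]
          exact hcoeff g
    _ = (f ^ n).coeff.support.card * C ^ n := by rw [Finset.sum_const, nsmul_eq_mul]
    _ ≤ _ := by
      gcongr
      exact_mod_cast card_support_pow_le f n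

end GroupAlgebra

/-! ### Points of the spectrum versus characters of a generating group -/

section CharacterSpace

open WeakDual

variable {G B : Type*} [CommGroup G] [NormedRing B] [NormedAlgebra ℂ B] [CompleteSpace B]
  (h : G →* B)

/-- Every character of `G` extends to a completion of the group algebra for which the characters of
`G` are bounded. -/
theorem exists_characterSpace_apply_eq (hd : DenseRange (MonoidAlgebra.lift ℂ B G h))
    (hb : ∀ (χ : G →* Circle) f, ‖groupAlgebraEval χ f‖ ≤ ‖MonoidAlgebra.lift ℂ B G h f‖)
    (χ : G →* Circle) : ∃ φ : characterSpace ℂ B, ∀ a, φ (h a) = χ a := by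
  have hd' : DenseRange (MonoidAlgebra.lift ℂ B G h).toLinearMap := hd
  -- By `hb`, evaluation at `χ` factors through the image of the group algebra and is bounded there,
  -- so it extends from this dense image to `B`.
  set ψ := (groupAlgebraEval χ).toLinearMap.extendOfNorm (MonoidAlgebra.lift ℂ B G h).toLinearMap
  have hψ : ∀ f, ψ (MonoidAlgebra.lift ℂ B G h f) = groupAlgebraEval χ f :=
    LinearMap.extendOfNorm_eq hd' ⟨1, fun f => by
      rw [one_mul]
      exact hb χ f⟩
  have hone : ψ 1 = 1 := by rw [← map_one (MonoidAlgebra.lift ℂ B G h), hψ, map_one]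
  have hmul : ∀ f g, ψ (f * g) = ψ f * ψ g := by
    refine hd.induction_on₂ (isClosed_eq ?_ ?_) fun f g => ?_
    · exact ψ.continuous.comp continuous_mul
    · exact (ψ.continuous.comp continuous_fst).mul (ψ.continuous.comp continuous_snd)
    · rw [← map_mul, hψ, hψ, hψ, map_mul]
  refine ⟨CharacterSpace.equivAlgHom.symm (AlgHom.ofLinearMap ψ.toLinearMap hone hmul),
    fun a => ?_⟩
  change ψ (h a) = χ a
  rw [← MonoidAlgebra.lift_of (R := ℂ) h a, hψ, groupAlgebraEval, MonoidAlgebra.lift_of]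
  rfl

/-- The values at `a` and `a⁻¹` both have modulus at most 1, and their product is 1. -/
theorem norm_characterSpace_apply_eq_one (hn : ∀ a, ‖h a‖ ≤ 1) (φ : characterSpace ℂ B) (a : G) :
    ‖φ (h a)‖ = 1 := by
  have h1 : ‖(1 : B)‖ ≤ 1 := map_one h ▸ hn 1
  have hle : ∀ b, ‖φ (h b)‖ ≤ 1 := fun b =>
    (AlgHom.norm_apply_le_self_mul_norm_one φ _).trans
      (mul_le_one₀ (hn b) (norm_nonneg _) h1)
  have hmul : ‖φ (h a)‖ * ‖φ (h a⁻¹)‖ = 1 := by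
    rw [← norm_mul, ← map_mul, ← map_mul, mul_inv_cancel, map_one, map_one, norm_one]
  refine le_antisymm (hle a) ?_
  rw [← hmul]
  exact mul_le_of_le_one_right (norm_nonneg _) (hle a⁻¹)

/-- The restriction of a point of the spectrum of `B` to the group `G`. -/
def characterSpaceRestrict (hn : ∀ a, ‖h a‖ ≤ 1) (φ : characterSpace ℂ B) : G →* Circle where
  toFun a := ⟨φ (h a), mem_sphere_zero_iff_norm.mpr (norm_characterSpace_apply_eq_one h hn φ a)⟩
  map_one' := Circle.ext (by simp)
  map_mul' a b := Circle.ext ((congrArg φ (map_mul h a b)).trans (map_mul φ _ _))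

theorem characterSpaceRestrict_bijective (hn : ∀ a, ‖h a‖ ≤ 1)
    (hd : DenseRange (MonoidAlgebra.lift ℂ B G h))
    (hb : ∀ (χ : G →* Circle) f, ‖groupAlgebraEval χ f‖ ≤ ‖MonoidAlgebra.lift ℂ B G h f‖) :
    Function.Bijective (characterSpaceRestrict h hn) := by
  refine ⟨fun φ φ' hφ => ?_, fun χ => ?_⟩
  · refine DFunLike.coe_injective (hd.equalizer (map_continuous φ) (map_continuous φ') ?_)
    funext f
    simp only [Function.comp_apply]
    induction f using MonoidAlgebra.induction_on with
    | of a =>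
      rw [MonoidAlgebra.lift_of]
      exact congrArg (fun χ : G →* Circle => (χ a : ℂ)) hφ
    | add f g hf hg => rw [map_add, map_add, map_add, hf, hg]
    | smul c f hf => rw [map_smul, map_smul, map_smul, hf]
  · obtain ⟨φ, hφ⟩ := exists_characterSpace_apply_eq h hd hb χ
    exact ⟨φ, MonoidHom.ext fun a => Circle.ext (hφ a)⟩

end CharacterSpace

/-! ### Transfer to the closure of a spanned star subalgebra -/

section Closure

open WeakDual

variable {G B : Type*} [CommGroup G] [NormedRing B] [NormedAlgebra ℂ B] [CompleteSpace B]
  [StarRing B] [NormedStarGroup B] [StarModule ℂ B]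

/-- The points of the spectrum of the closed span of a group of contractions correspond to the
characters of the group, if these are bounded on the span. -/
theorem exists_equiv_characterSpace_topologicalClosure (S : StarSubalgebra ℂ B) (h : G →* B)
    (hS : ∀ x ∈ S, x ∈ Submodule.span ℂ (range h)) (hn : ∀ a, ‖h a‖ ≤ 1)
    (hb : ∀ (χ : G →* Circle) f, ‖groupAlgebraEval χ f‖ ≤ ‖MonoidAlgebra.lift ℂ B G h f‖)
    (k : G → S.topologicalClosure) (hk : ∀ a, (k a : B) = h a) :
    ∃ Φ : characterSpace ℂ S.topologicalClosure ≃ (G →* Circle),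
      ∀ φ a, (Φ φ a : ℂ) = φ (k a) := by
  let k' : G →* S.topologicalClosure :=
    { toFun := k
      map_one' := Subtype.ext ((hk 1).trans (map_one h))
      map_mul' := fun a b => Subtype.ext <| by
        rw [hk, map_mul, ← hk, ← hk]
        rfl }
  have hcoe : ∀ f, (MonoidAlgebra.lift ℂ S.topologicalClosure G k' f : B)
      = MonoidAlgebra.lift ℂ B G h f := fun f => by
    induction f using MonoidAlgebra.induction_on with
    | of a => rw [MonoidAlgebra.lift_of, MonoidAlgebra.lift_of]; exact hk a
    | add f g hf hg => rw [map_add, map_add, ← hf, ← hg]; rfl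
    | smul c f hf => rw [map_smul, map_smul, ← hf]; rfl
  have hspan : Submodule.span ℂ (range h)
      ≤ LinearMap.range (MonoidAlgebra.lift ℂ B G h).toLinearMap := by
    rw [Submodule.span_le]
    rintro _ ⟨a, rfl⟩
    exact ⟨MonoidAlgebra.of ℂ _ a, MonoidAlgebra.lift_of _ _⟩
  have hd : DenseRange (MonoidAlgebra.lift ℂ S.topologicalClosure G k') := by
    intro f
    -- Density inside the closure is checked in `B`, where it suffices to reach every element of
    -- `S`.
    rw [closure_subtype]
    refine closure_mono (fun g hg => ?_) f.2
    obtain ⟨p, hp⟩ := hspan (hS g hg)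
    exact ⟨_, ⟨p, rfl⟩, (hcoe p).trans hp⟩
  have hn' : ∀ a, ‖k' a‖ ≤ 1 := fun a => (congrArg norm (hk a)).trans_le (hn a)
  exact ⟨Equiv.ofBijective (characterSpaceRestrict k' hn')
    (characterSpaceRestrict_bijective k' hn' hd fun χ f =>
      (hb χ f).trans_eq (congrArg norm (hcoe f)).symm), fun _ _ => rfl⟩

end Closure

/-! ### The character bound for the sup norm -/

section BoundedFunctions

variable {G V : Type*} [CommGroup G] [AddCommGroup V] {e : V → G →* Circle}

theorem norm_groupAlgebraEval_le_norm_lift (he : ∀ A B g, e (A + B) g = e A g * e B g)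
    (hsep : ∀ a b : G, a ≠ b → ∃ A, (e A a : ℂ) = -e A b)
    (h : G →* lp (fun _ : V => ℂ) ∞) (hh : ∀ a A, h a A = e A a) (χ : G →* Circle)
    (f : MonoidAlgebra ℂ G) :
    ‖groupAlgebraEval χ f‖ ≤ ‖MonoidAlgebra.lift ℂ (lp (fun _ : V => ℂ) ∞) G h f‖ := by
  refine norm_groupAlgebraEval_le he hsep χ f fun A => ?_
  -- Evaluation at the point `A` of `V` is the character `e A`, so its modulus is at most the sup
  -- norm.
  have heval : groupAlgebraEval (e A) f = MonoidAlgebra.lift ℂ (lp (fun _ : V => ℂ) ∞) G h f A := by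
    induction f using MonoidAlgebra.induction_on with
    | of a =>
      rw [groupAlgebraEval, MonoidAlgebra.lift_of, MonoidAlgebra.lift_of, hh]
      rfl
    | add f g hf hg => rw [map_add, map_add, hf, hg]; rfl
    | smul c f hf => rw [map_smul, map_smul, hf]; rfl
  rw [heval]
  exact lp.norm_apply_le_norm ENNReal.top_ne_zero _ A

end BoundedFunctions

/-! ### Application to the hoop group -/

section Spectrum

variable {M : Type*} [TopologicalSpace M] [ChartedSpace E3 M] [IsManifold 𝓘(ℝ, E3) ∞ M]
variable (𝒜 : Submodule ℝ (OneForm M)) (x₀ : M)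

/-- The evaluation of hoops at a connection. -/
def holonomyHom (A : 𝒜) : HoopGroup 𝒜 x₀ →* Circle where
  toFun a := a.hol A
  map_one' := HoopGroup.hol_one A
  map_mul' a b := HoopGroup.hol_mul a b A

/-- The holonomy functions, as a homomorphism on the hoop group. -/
def holonomyFunHom : HoopGroup 𝒜 x₀ →* BoundedFunctions 𝒜 where
  toFun := holonomyFun 𝒜 x₀
  map_one' := holonomyFun_one 𝒜 x₀
  map_mul' := holonomyFun_mul 𝒜 x₀

/-- The points of the spectrum of the holonomy `C⋆`-algebra correspond to the characters of the
hoop group. -/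
theorem exists_equiv_characterSpace_holonomyCStarAlgebra :
    ∃ Φ : WeakDual.characterSpace ℂ (HolonomyCStarAlgebra 𝒜 x₀) ≃ (HoopGroup 𝒜 x₀ →* Circle),
      ∀ φ a, (Φ φ a : ℂ) = φ (hoopElement 𝒜 x₀ a) :=
  exists_equiv_characterSpace_topologicalClosure (holonomyAlgebra 𝒜 x₀) (holonomyFunHom 𝒜 x₀)
    (fun _ hx => hx)
    (fun a => lp.norm_le_of_forall_le zero_le_one fun A => (Circle.norm_coe (a.hol A)).le)
    (norm_groupAlgebraEval_le_norm_lift (e := holonomyHom 𝒜 x₀) (fun A B a => a.hol_add A B)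
      (fun _ _ h => HoopGroup.exists_hol_eq_neg h) (holonomyFunHom 𝒜 x₀) fun _ _ => rfl)
    (hoopElement 𝒜 x₀) fun _ => rfl

end Spectrum

end AbelianHolonomy

end

theorem theoremA4 {M : Type*} [TopologicalSpace M] [T2Space M] [SecondCountableTopology M]
    [ChartedSpace AbelianHolonomy.E3 M] [IsManifold 𝓘(ℝ, AbelianHolonomy.E3) ∞ M]
    (x₀ : M) (𝒜 : Submodule ℝ (AbelianHolonomy.OneForm M))
    (h𝒜 : ∀ A : AbelianHolonomy.OneForm M, A.IsSmooth → A.IsCompactlySupported → A ∈ 𝒜) :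
    IsMulTorsionFree (AbelianHolonomy.HoopGroup 𝒜 x₀) ∧
      ∃ Φ : WeakDual.characterSpace ℂ (AbelianHolonomy.HolonomyCStarAlgebra 𝒜 x₀) ≃
          (AbelianHolonomy.HoopGroup 𝒜 x₀ →* Circle),
        ∀ (φ : WeakDual.characterSpace ℂ (AbelianHolonomy.HolonomyCStarAlgebra 𝒜 x₀))
          (a : AbelianHolonomy.HoopGroup 𝒜 x₀),
          (Φ φ a : ℂ) = φ (AbelianHolonomy.hoopElement 𝒜 x₀ a) :=
  ⟨AbelianHolonomy.HoopGroup.isMulTorsionFree,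
    AbelianHolonomy.exists_equiv_characterSpace_holonomyCStarAlgebra 𝒜 x₀⟩
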